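/- All graphs are finite and undirected; loops and parallel edges are allowed, a loop counts twice in the degree, and a graph need not be connected. A vertex $v$ is a cut-vertex of $G$ if $G-v$ has more connected components than $G$. A plane embedding of $G$ gives the cyclic embedding order of the half-edges (ends of edges) at every vertex; $G$ is planar if it has a plane embedding. Let $G$ be a 4-regular graph embedded in the plane. An orientation of a vertex $v$ is a partition of the four half-edges at $v$ into two cells, each consisting of two half-edges that are consecutive in the embedding order at $v$. A vertex $v$ with an incident loop (a loop-anchor) is oriented transversely if no cell at $v$ consists of the two halves of one loop: if there is one loop $e$ and two other edges $f,g$ at $v$, the cells are then $\{e,f\}$ and $\{e,g\}$; if there are two loops $e_1,e_2$ at $v$, both cells are $\{e_1,e_2\}$. A vertex-orientation $\sigma$ of $G$ assigns an orientation to every vertex. A 3-o-colouring of $(G,\sigma)$ is an assignment of at most three colours to the edges of $G$ such that at each vertex exactly two colours appear on the incident edges, and both of these colours appear in each of the two cells of $\sigma$ at that vertex. **Theorem.** The four colour theorem (the vertices of every loopless planar graph can be coloured with four colours so that adjacent vertices have different colours) is equivalent to the following assertion: for every 4-regular graph $G$ embedded in the plane and without a cut-vertex, and every vertex-orientation $\sigma$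 of $G$ in which each loop-anchor is oriented transversely, $(G,\sigma)$ has a 3-o-colouring. -/

import Mathlib

/-- A graph, loops and parallel edges allowed, with vertex set `V` and edge set `E`.
The edge `e` joins `ends e false` and `ends e true`; the labelling of its two ends by `Bool` is only
bookkeeping, all graphs are undirected. -/
structure Multigraph (V E : Type) where
  ends : E → Bool → V

namespace Multigraph

variable {V E : Type}

/-- The vertex to which a half-edge is attached. The half-edges are the pairs `(e, b)`: every edge,
a loop too, has the two half-edges `(e, false)` and `(e, true)`. -/
def base (G : Multigraph V E) (h : E × Bool) : V := G.ends h.1 h.2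

/-- The other half of the same edge. -/
def opp (E : Type) : Equiv.Perm (E × Bool) where
  toFun h := (h.1, !h.2)
  invFun h := (h.1, !h.2)
  left_inv h := by simp
  right_inv h := by simp

/-- The degree of a vertex; a loop counts twice. -/
noncomputable def degree (G : Multigraph V E) (v : V) : ℕ := Nat.card {h : E × Bool // G.base h = v}

def IsRegular (G : Multigraph V E) (k : ℕ) : Prop := ∀ v, G.degree v = k

def Loopless (G : Multigraph V E) : Prop := ∀ e, G.ends e false ≠ G.ends e true

/-- A vertex with an incident loop. -/
def IsLoopAnchor (G : Multigraph V E) (v : V) : Prop :=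
  ∃ e, G.ends e false = v ∧ G.ends e true = v

def Adj (G : Multigraph V E) (u w : V) : Prop :=
  ∃ h : E × Bool, G.base h = u ∧ G.base (opp E h) = w

/-- `u` and `w` are in the same connected component. -/
def Reachable (G : Multigraph V E) (u w : V) : Prop := Relation.ReflTransGen G.Adj u w

/-- `u` and `w`, vertices different from `v`, are joined by a walk that avoids `v`, i.e. they are in
the same connected component of `G - v`. -/
def ReachableAvoiding (G : Multigraph V E) (v u w : V) : Prop :=
  Relation.ReflTransGen (fun a b => G.Adj a b ∧ a ≠ v ∧ b ≠ v) u w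

/-- `v` is a cut-vertex: its deletion splits a connected component into several ones, i.e. `G - v`
has more components than `G`. -/
def IsCutVertex (G : Multigraph V E) (v : V) : Prop :=
  ∃ u w, u ≠ v ∧ w ≠ v ∧ G.Reachable u w ∧ ¬ G.ReachableAvoiding v u w

/-- A rotation system (combinatorial embedding in an oriented surface): a permutation of the
half-edges, each cycle of which consists of all the half-edges at one vertex. `rot h` is the
half-edge that follows `h` in the cyclic embedding order at its vertex. -/
structure RotationSystem (G : Multigraph V E) where
  rot : Equiv.Perm (E × Bool)
  sameCycle_iff : ∀ h k, rot.SameCycle h k ↔ G.base h = G.base k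

/-- The cycles of this permutation are the boundary walks of the faces: go along an edge to its other
end, then turn to the next half-edge there. -/
def RotationSystem.facePerm {G : Multigraph V E} (R : G.RotationSystem) :
    Equiv.Perm (E × Bool) := R.rot * opp E

/-- The connected components of `G` that contain an edge, as classes of half-edges (`Quot` is the
quotient by the equivalence relation generated by the given relation). -/
def EdgeComponents (G : Multigraph V E) : Type :=
  Quot (fun h k : E × Bool => G.base h = G.base k ∨ k = opp E h)

/-- The embedding of the finite graph `G` given by the rotation system is an embedding in the plane
(sphere), i.e. every component has genus zero. A component with `p` vertices, `q ≥ 1` edges and `r`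
face cycles has genus `g ≥ 0` with `p - q + r = 2 - 2 g`, so that all genera are zero if and only if
Euler's formula holds for the sums over all these components. A component without edges is an isolated
vertex and puts no restriction on the embedding. -/
def RotationSystem.IsPlane {G : Multigraph V E} (R : G.RotationSystem) : Prop :=
  Nat.card (Set.range G.base) + Nat.card (Quotient (Equiv.Perm.SameCycle.setoid R.facePerm)) =
    Nat.card E + 2 * Nat.card G.EdgeComponents

/-- A planar graph: one with an embedding in the plane. -/
def IsPlanar (G : Multigraph V E) : Prop := ∃ R : G.RotationSystem, R.IsPlane

/-- `σ` is a vertex-orientation of the 4-regular graph `G` embedded by `R`: `σ v` is the set of edge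
cells at `v`, and these form a partition of the half-edges at `v` into pairs of half-edges that are
consecutive in the embedding order at `v`. A loop counts as two half-edges at its vertex. -/
structure RotationSystem.IsVertexOrientation {G : Multigraph V E} (R : G.RotationSystem)
    (σ : V → Set (Set (E × Bool))) : Prop where
  consecutive : ∀ v, ∀ c ∈ σ v, ∃ h, G.base h = v ∧ c = {h, R.rot h}
  partition : ∀ h, ∃! c, c ∈ σ (G.base h) ∧ h ∈ c

/-- For a loop-anchor `v`: the vertex is oriented transversely, i.e. no edge cell at `v` consists of
the two halves of one loop. With one loop `e` and two further edges `f`, `g` the cells are then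
`{e, f}`, `{e, g}` (the other orientation is `{e, e}`, `{f, g}`); with two loops `e₁`, `e₂` both
cells are `{e₁, e₂}`. -/
def IsTransverseAt (σ : V → Set (Set (E × Bool))) (v : V) : Prop :=
  ∀ e : E, ({(e, false), (e, true)} : Set (E × Bool)) ∉ σ v

/-- The set of colours on the edges at `v`. -/
def coloursAt (G : Multigraph V E) {k : ℕ} (ε : E → Fin k) (v : V) : Set (Fin k) :=
  {x | ∃ h, G.base h = v ∧ ε h.1 = x}

/-- `ε` is an o-colouring (with at most `k` colours) of the vertex-oriented graph `(G, σ)`: exactly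
two colours appear at each vertex, and both of them appear in each edge cell. -/
def IsOColouring (G : Multigraph V E) (σ : V → Set (Set (E × Bool))) {k : ℕ} (ε : E → Fin k) :
    Prop :=
  ∀ v, (G.coloursAt ε v).ncard = 2 ∧
    ∀ c ∈ σ v, ∀ x ∈ G.coloursAt ε v, ∃ h ∈ c, ε h.1 = x

/-- `(G, σ)` is `k`-o-colourable. -/
def IsOColourable (G : Multigraph V E) (k : ℕ) (σ : V → Set (Set (E × Bool))) : Prop :=
  ∃ ε : E → Fin k, G.IsOColouring σ ε

end Multigraph

/-- The assertion of the four colour theorem: the vertices of every finite loopless planar graph can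
be coloured with four colours so that the ends of every edge have different colours. -/
def FourColourTheorem : Prop :=
  ∀ (V E : Type) [Finite V] [Finite E] (G : Multigraph V E), G.Loopless → G.IsPlanar →
    ∃ c : V → Fin 4, ∀ e, c (G.ends e false) ≠ c (G.ends e true)

/-! Plane graphs are treated as pairs of permutations of the half-edges (darts): `f` rotates about
the vertices, `g` exchanges the halves of each edge, `f * g` runs round the faces, and planarity is
Euler's formula for the cycle counts. The three colours are viewed as the non-zero elements of 𝔽₂²,
so that an edge colour can be the difference of two potentials with values in 𝔽₂².

From four colours to an o-colouring: in the dual of `G` every vertex of `G` is a quadrangle. Draw in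
it the diagonal that joins the two corners lying between the cells of `σ`. The result is planar. It
is loopless: even degrees exclude bridges, and a diagonal that is a loop would produce a cut-vertex
or a cell consisting of a loop. Four-colour the faces of `G` accordingly and give each edge the
difference of its two sides. With face colours i, j, k, l round a vertex and i ≠ k, the edges of a
cell get i + j ≠ j + k, and l, being j or the fourth colour, gives the other cell the same two
colours.

From o-colourings to four colours: double every edge of a loopless plane graph and take the medial
graph, whose vertices are edges and whose edges are corners. It is plane and 4-regular, and doubling
has removed its cut-vertices. Orient it so that each cell at an edge e consists of the two corners
on one side of e. The two cells of an o-colouring have equal colour sums, so the colours sum to zero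
at each medial vertex; on the sphere they are therefore differences of a potential on the medial
faces, which are the vertices and faces of the graph. Passing from one end of e to the other through
a cell changes the potential by the sum of two different colours, which is not zero: the potential
is a four-colouring.

Both directions use that on the sphere the spaces spanned by the vertex and by the face coboundaries
mod 2 are orthogonal complements (`coboundary_dotProduct_coboundary`,
`IsSpherical.card_le_finrank_add`). -/

namespace Equiv.Perm

/-! ### Cycles of permutations and pairs of genus zero. -/

variable {D : Type}

/-- The cycles of a permutation, fixed points included. -/
abbrev Cycles (f : Equiv.Perm D) : Type := Quot fun x y => f x = y

/-- The class of a point in the set of cycles. -/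
abbrev cycleMk (f : Equiv.Perm D) (x : D) : f.Cycles :=
  Quot.mk (fun x y => f x = y) x

/-- The orbits of the group generated by two permutations. -/
abbrev CommonOrbits (f g : Equiv.Perm D) : Type := Quot fun x y => f x = y ∨ g x = y

/-- The Euler formula for a pair of permutations (a hypermap) all of whose components have genus
zero. -/
def IsSpherical (f g : Equiv.Perm D) : Prop :=
  Nat.card f.Cycles + Nat.card g.Cycles + Nat.card (f * g).Cycles =
    Nat.card D + 2 * Nat.card (f.CommonOrbits g)

theorem cycleMk_apply (f : Equiv.Perm D) (x : D) : f.cycleMk (f x) = f.cycleMk x :=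
  (Quot.sound (r := fun x y => f x = y) rfl).symm

theorem cycleMk_eq_iff {f : Equiv.Perm D} {x y : D} :
    f.cycleMk x = f.cycleMk y ↔ f.SameCycle x y := by
  constructor
  · intro h
    replace h := Quot.eqvGen_exact h
    induction h with
    | rel a b h => exact ⟨1, by simpa using h⟩
    | refl a => exact .refl _ _
    | symm a b _ ih => exact ih.symm
    | trans a b c _ _ ih1 ih2 => exact ih1.trans ih2
  · rintro ⟨n, rfl⟩
    induction n using Int.induction_on with
    | zero => simp
    | succ n ih => rw [ih, add_comm, zpow_add, zpow_one, mul_apply, cycleMk_apply]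
    | pred n ih =>
      rw [ih, ← cycleMk_apply f ((f ^ (-(n : ℤ) - 1)) x), ← mul_apply, ← zpow_one_add]
      simp

theorem SameCycle.apply_eq {β : Type} {f : Equiv.Perm D} {x y : D} (h : f.SameCycle x y)
    {c : D → β} (hc : ∀ x, c (f x) = c x) : c x = c y :=
  congrArg (Quot.lift c (by rintro a _ rfl; exact (hc a).symm)) (cycleMk_eq_iff.2 h)

theorem card_sameCycle_quotient (f : Equiv.Perm D) :
    Nat.card (Quotient (SameCycle.setoid f)) = Nat.card f.Cycles :=
  Nat.card_congr ⟨Quotient.lift f.cycleMk fun _ _ h => cycleMk_eq_iff.2 h,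
    Quot.lift (fun x => Quotient.mk _ x) (by rintro x _ rfl; exact Quotient.sound ⟨1, by simp⟩),
    by rintro ⟨x⟩; rfl, by rintro ⟨x⟩; rfl⟩

/-- The cycles of a conjugate permutation. -/
theorem card_cycles_congr {D' : Type} (e : D ≃ D') {f : Equiv.Perm D} {f' : Equiv.Perm D'}
    (h : ∀ x, e (f x) = f' (e x)) : Nat.card f.Cycles = Nat.card f'.Cycles :=
  Nat.card_congr (Quot.congr e fun x y => by rw [← h, e.apply_eq_iff_eq])

theorem card_commonOrbits_congr {D' : Type} (e : D ≃ D') {f g : Equiv.Perm D}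
    {f' g' : Equiv.Perm D'} (h : ∀ x, e (f x) = f' (e x)) (h' : ∀ x, e (g x) = g' (e x)) :
    Nat.card (f.CommonOrbits g) = Nat.card (f'.CommonOrbits g') :=
  Nat.card_congr (Quot.congr e fun x y => by
    rw [← h, ← h', e.apply_eq_iff_eq, e.apply_eq_iff_eq])

theorem IsSpherical.congr {D' : Type} (e : D ≃ D') {f g : Equiv.Perm D}
    {f' g' : Equiv.Perm D'} (h : ∀ x, e (f x) = f' (e x)) (h' : ∀ x, e (g x) = g' (e x))
    (hs : f.IsSpherical g) : f'.IsSpherical g' := by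
  unfold IsSpherical at *
  rw [← card_cycles_congr e h, ← card_cycles_congr e h', ← card_commonOrbits_congr e h h',
    ← card_cycles_congr e (f := f * g) (f' := f' * g') (by simp [h, h']), hs, Nat.card_congr e]

theorem cycleMk_eq_iff_of_involutive {g : Equiv.Perm D} (hg : ∀ x, g (g x) = x)
    {x y : D} :
    g.cycleMk x = g.cycleMk y ↔ x = y ∨ x = g y := by
  constructor
  · intro h
    replace h := Quot.eqvGen_exact h
    induction h with
    | rel a b h => exact .inr (by rw [← h, hg])
    | refl a => exact .inl rfl
    | symm a b _ ih =>
      rcases ih with h | h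
      · exact .inl h.symm
      · exact .inr (by rw [h, hg])
    | trans a b c _ _ ih1 ih2 =>
      rcases ih1 with rfl | rfl <;> rcases ih2 with rfl | rfl <;> simp [hg]
  · rintro (rfl | rfl)
    · rfl
    · exact cycleMk_apply _ _

/-- A fixed-point-free involution interchanges the two ends of edges. -/
theorem exists_equiv_cycles_prod_bool {g : Equiv.Perm D} (hg : ∀ x, g (g x) = x)
    (hg' : ∀ x, g x ≠ x) :
    ∃ e : D ≃ g.Cycles × Bool, ∀ x, e (g x) = Multigraph.opp g.Cycles (e x) := by
  have key (x : D) : x = (g.cycleMk x).out ∨ x = g (g.cycleMk x).out :=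
    (cycleMk_eq_iff_of_involutive hg).1 (Quot.out_eq (g.cycleMk x)).symm
  let e' : g.Cycles × Bool → D := fun p => if p.2 then g p.1.out else p.1.out
  have mk_e' (p) : g.cycleMk (e' p) = p.1 := by
    rcases p with ⟨q, _ | _⟩ <;> simp [e', cycleMk_apply]
  have he' : Function.Bijective e' := by
    constructor
    · intro p p' h
      have h1 : p.1 = p'.1 := by rw [← mk_e' p, ← mk_e' p', h]
      rcases p with ⟨q, b⟩
      rcases p' with ⟨q', b'⟩
      obtain rfl : q = q' := h1
      have := hg' q.out
      cases b <;> cases b'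
      · rfl
      · exact absurd (Eq.symm h) this
      · exact absurd h this
      · rfl
    · intro x
      rcases key x with h | h
      · exact ⟨(g.cycleMk x, false), by simpa [e'] using h.symm⟩
      · exact ⟨(g.cycleMk x, true), by simpa [e'] using h.symm⟩
  refine ⟨(Equiv.ofBijective e' he').symm, fun x => ?_⟩
  rw [Equiv.symm_apply_eq]
  obtain ⟨p, rfl⟩ := he'.2 x
  rw [Equiv.ofBijective_symm_apply_apply]
  rcases p with ⟨q, _ | _⟩ <;> simp [e', Multigraph.opp, hg]

theorem card_eq_two_mul_card_cycles {g : Equiv.Perm D} (hg : ∀ x, g (g x) = x)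
    (hg' : ∀ x, g x ≠ x) : Nat.card D = 2 * Nat.card g.Cycles := by
  obtain ⟨e, -⟩ := exists_equiv_cycles_prod_bool hg hg'
  rw [Nat.card_congr e, Nat.card_prod, mul_comm]
  simp

/-- A map and its dual have the same components. -/
theorem commonOrbits_mul_right (f g : Equiv.Perm D) :
    Nat.card ((f * g).CommonOrbits g) = Nat.card (f.CommonOrbits g) := by
  refine Nat.card_congr ⟨Quot.lift (fun x => Quot.mk _ x) ?_, Quot.lift (fun x => Quot.mk _ x) ?_,
    ?_, ?_⟩
  · rintro x y (rfl | rfl)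
    · exact (Quot.sound (.inr rfl)).trans (Quot.sound (.inl rfl))
    · exact Quot.sound (.inr rfl)
  · rintro x y (rfl | rfl)
    · obtain ⟨x, rfl⟩ := g.surjective x
      exact (Quot.sound (.inr rfl) : Quot.mk _ x = _).symm.trans (Quot.sound (.inl rfl))
    · exact Quot.sound (.inr rfl)
  · rintro ⟨x⟩; rfl
  · rintro ⟨x⟩; rfl

end Equiv.Perm

/-! ### Plane multigraphs as spherical pairs of permutations. -/

namespace Multigraph

open Equiv.Perm

variable {V E : Type} {G : Multigraph V E}

@[simp] theorem opp_opp (h : E × Bool) : opp E (opp E h) = h := by simp [opp]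

theorem opp_ne (h : E × Bool) : opp E h ≠ h := by
  intro H
  simpa [opp] using congrArg Prod.snd H

theorem eq_or_eq_opp {h k : E × Bool} (H : h.1 = k.1) : h = k ∨ h = opp E k := by
  rcases h with ⟨e, b⟩
  rcases k with ⟨e', b'⟩
  obtain rfl : e = e' := H
  cases b <;> cases b' <;> simp [opp]

theorem card_cycles_opp : Nat.card (opp E).Cycles = Nat.card E := by
  refine Nat.card_congr ⟨Quot.lift Prod.fst (by rintro h _ rfl; rfl),
    fun e => Quot.mk _ (e, false), ?_, fun e => rfl⟩
  rintro ⟨e, _ | _⟩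
  · rfl
  · exact Quot.sound rfl

theorem RotationSystem.isPlane_iff (R : G.RotationSystem) :
    R.IsPlane ↔ R.rot.IsSpherical (opp E) := by
  have h1 : Nat.card (Set.range G.base) = Nat.card R.rot.Cycles := by
    refine (Nat.card_congr (Equiv.ofBijective (Quot.lift (Set.rangeFactorization G.base) ?_) ⟨?_, ?_⟩)).symm
    · rintro x _ rfl
      exact Subtype.ext ((R.sameCycle_iff _ _).1 ⟨1, by simp⟩)
    · rintro ⟨x⟩ ⟨y⟩ h
      exact cycleMk_eq_iff.2 ((R.sameCycle_iff _ _).2 (congrArg Subtype.val h))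
    · rintro ⟨_, x, rfl⟩
      exact ⟨Quot.mk _ x, rfl⟩
  have h2 : Nat.card G.EdgeComponents = Nat.card (R.rot.CommonOrbits (opp E)) := by
    refine Nat.card_congr ⟨Quot.lift (fun x => Quot.mk _ x) ?_,
      Quot.lift (fun x => Quot.mk _ x) ?_, ?_, ?_⟩
    · rintro x y (h | rfl)
      · exact ((R.sameCycle_iff x y).2 h).apply_eq fun z => (Quot.sound (.inl rfl)).symm
      · exact Quot.sound (.inr rfl)
    · rintro x y (rfl | rfl)
      · exact Quot.sound (.inl ((R.sameCycle_iff _ _).1 ⟨1, by simp⟩))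
      · exact Quot.sound (.inr rfl)
    · rintro ⟨x⟩; rfl
    · rintro ⟨x⟩; rfl
  have h3 : Nat.card (E × Bool) = 2 * Nat.card E := by
    rw [Nat.card_prod, mul_comm]
    simp
  rw [RotationSystem.IsPlane, IsSpherical, h1, h2, h3, card_sameCycle_quotient, card_cycles_opp,
    RotationSystem.facePerm]
  omega

end Multigraph

/-- The four colour theorem for spherical pairs of permutations. -/
theorem FourColourTheorem.exists_colouring_of_isSpherical (H : FourColourTheorem) {D : Type}
    [Finite D] {f g : Equiv.Perm D} (hg : ∀ x, g (g x) = x) (hg' : ∀ x, g x ≠ x)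
    (hs : f.IsSpherical g) (hl : ∀ x, f.cycleMk (g x) ≠ f.cycleMk x) :
    ∃ c : D → Fin 4, (∀ x, c (f x) = c x) ∧ ∀ x, c (g x) ≠ c x := by
  obtain ⟨e, he⟩ := Equiv.Perm.exists_equiv_cycles_prod_bool hg hg'
  let G : Multigraph f.Cycles g.Cycles := ⟨fun q b => f.cycleMk (e.symm (q, b))⟩
  have hbase (h) : G.base h = f.cycleMk (e.symm h) := rfl
  let R : G.RotationSystem := ⟨e.permCongr f, fun h k => by
    rw [hbase, hbase, Equiv.Perm.cycleMk_eq_iff, Equiv.Perm.SameCycle, Equiv.Perm.SameCycle]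
    refine exists_congr fun n => ?_
    rw [show e.permCongr f = e.permCongrHom f from rfl, ← map_zpow, Equiv.eq_symm_apply]
    rfl⟩
  have hopp (h) : e.symm (Multigraph.opp _ h) = g (e.symm h) := by
    rw [Equiv.symm_apply_eq, he, Equiv.apply_symm_apply]
  have hR : R.IsPlane := R.isPlane_iff.2 (hs.congr e (fun x => by simp [R]) he)
  obtain ⟨c, hc⟩ := H _ _ G (fun q h => by
    have := hopp (q, false)
    exact hl (e.symm (q, false)) (by rw [← this]; exact h.symm)) ⟨R, hR⟩
  refine ⟨fun x => c (f.cycleMk x), fun x => congrArg c (f.cycleMk_apply x), fun x => ?_⟩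
  obtain ⟨⟨q, b⟩, rfl⟩ := e.symm.surjective x
  change c (f.cycleMk (g _)) ≠ _
  rw [← hopp]
  cases b
  · exact (hc q).symm
  · exact hc q

/-! ### Homology mod 2 on the sphere. -/

/-- If two orthogonal subspaces have complementary dimensions, then the one contains everything that
is orthogonal to the other. -/
theorem Submodule.mem_of_dotProduct_eq_zero {K E : Type} [Field K] [Fintype E]
    {W W' : Submodule K (E → K)} (h : ∀ w ∈ W, ∀ w' ∈ W', w ⬝ᵥ w' = 0)
    (hdim : Fintype.card E ≤ Module.finrank K W + Module.finrank K W') {x : E → K}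
    (hx : ∀ w ∈ W, w ⬝ᵥ x = 0) : x ∈ W' := by
  classical
  set U : Submodule K (Module.Dual K (E → K)) := W.map (dotProductEquiv K E).toLinearMap with hU
  have hle : W' ≤ U.dualCoannihilator := by
    intro w' hw'
    rw [Submodule.mem_dualCoannihilator]
    rintro _ ⟨w, hw, rfl⟩
    exact h w hw w' hw'
  have h1 := Subspace.finrank_add_finrank_dualCoannihilator_eq U
  have h2 : Module.finrank K U = Module.finrank K W := LinearEquiv.finrank_map_eq _ _
  rw [Module.finrank_fintype_fun_eq_card, h2] at h1
  rw [Submodule.eq_of_le_of_finrank_le hle (by omega), Submodule.mem_dualCoannihilator]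
  rintro _ ⟨w, hw, rfl⟩
  exact hx w hw

namespace Equiv.Perm

open Multigraph (opp opp_opp)

variable {E : Type} (f : Equiv.Perm (E × Bool))

/-- The coboundary operator mod 2 on functions that are constant on the cycles of `f`. -/
def coboundary : (f.Cycles → ZMod 2) →ₗ[ZMod 2] (E → ZMod 2) where
  toFun z e := z (f.cycleMk (e, false)) + z (f.cycleMk (e, true))
  map_add' z z' := by
    ext e
    simp only [Pi.add_apply]
    ring
  map_smul' r z := by
    ext e
    simp [mul_add]

theorem coboundary_apply (z : f.Cycles → ZMod 2) (h : E × Bool) :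
    f.coboundary z h.1 = z (f.cycleMk h) + z (f.cycleMk (opp E h)) := by
  rcases h with ⟨e, _ | _⟩
  · rfl
  · exact add_comm _ _

/-- The kernel consists of the functions constant on components, so the rank is the number of
vertices minus the number of components. -/
theorem finrank_range_coboundary [Finite E] :
    Module.finrank (ZMod 2) (LinearMap.range f.coboundary) + Nat.card (f.CommonOrbits (opp E)) =
      Nat.card f.Cycles := by
  classical
  have : Fintype f.Cycles := Fintype.ofFinite _
  have : Fintype (f.CommonOrbits (opp E)) := Fintype.ofFinite _
  let p : f.Cycles → f.CommonOrbits (opp E) :=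
    Quot.lift (fun x => Quot.mk _ x) fun x y h => Quot.sound (.inl h)
  have hp : Function.Surjective p := by
    rintro ⟨x⟩
    exact ⟨f.cycleMk x, rfl⟩
  have hker : LinearMap.ker f.coboundary = LinearMap.range (LinearMap.funLeft (ZMod 2) (ZMod 2) p) := by
    ext z
    rw [LinearMap.mem_ker, LinearMap.mem_range]
    constructor
    · intro hz
      refine ⟨Quot.lift (fun x => z (f.cycleMk x)) ?_, ?_⟩
      · rintro x y (rfl | rfl)
        · exact congrArg z (f.cycleMk_apply x).symm
        · have := congrFun hz x.1
          rwa [coboundary_apply, Pi.zero_apply, CharTwo.add_eq_zero] at this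
      · ext ⟨x⟩
        rfl
    · rintro ⟨z, rfl⟩
      ext e
      have : p (f.cycleMk (e, false)) = p (f.cycleMk (e, true)) := Quot.sound (.inr rfl)
      simp [coboundary, LinearMap.funLeft, this, CharTwo.add_self_eq_zero]
  have h1 := LinearMap.finrank_range_add_finrank_ker f.coboundary
  rw [hker, LinearMap.finrank_range_of_inj (LinearMap.funLeft_injective_of_surjective _ _ _ hp),
    Module.finrank_fintype_fun_eq_card, Module.finrank_fintype_fun_eq_card] at h1
  simpa [Nat.card_eq_fintype_card] using h1

variable {f}

/-- The coboundaries of vertex functions are orthogonal to those of face functions. -/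
theorem coboundary_dotProduct_coboundary [Fintype E] (z : f.Cycles → ZMod 2)
    (y : (f * opp E).Cycles → ZMod 2) :
    f.coboundary z ⬝ᵥ (f * opp E).coboundary y = 0 := by
  have h1 : f.coboundary z ⬝ᵥ (f * opp E).coboundary y =
      ∑ h : E × Bool, z (f.cycleMk h) *
        (y ((f * opp E).cycleMk h) + y ((f * opp E).cycleMk (opp E h))) := by
    simp only [← coboundary_apply, Fintype.sum_prod_type, Fintype.sum_bool, ← add_mul, dotProduct]
    exact Finset.sum_congr rfl fun e _ => congrArg (· * _) (add_comm _ _)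
  -- The far side of `h` is the face at the next half-edge, so round each vertex every face term
  -- occurs twice.
  have h2 (h) : y ((f * opp E).cycleMk (opp E h)) = y ((f * opp E).cycleMk (f h)) := by
    rw [← cycleMk_apply _ (opp E h), mul_apply, opp_opp]
  have h3 : ∑ h, z (f.cycleMk h) * y ((f * opp E).cycleMk (f h)) =
      ∑ h, z (f.cycleMk h) * y ((f * opp E).cycleMk h) := by
    rw [← Equiv.sum_comp f fun h => z (f.cycleMk h) * y ((f * opp E).cycleMk h)]
    simp only [cycleMk_apply]
  simp only [h1, mul_add, h2, Finset.sum_add_distrib, h3, CharTwo.add_self_eq_zero]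

/-- Euler's formula, written as (p - k) + (r - k) = q for k components; the dual has the same
components. -/
theorem IsSpherical.card_le_finrank_add [Finite E] (hs : f.IsSpherical (opp E)) :
    Nat.card E ≤ Module.finrank (ZMod 2) (LinearMap.range f.coboundary) +
      Module.finrank (ZMod 2) (LinearMap.range (f * opp E).coboundary) := by
  have h1 := finrank_range_coboundary f
  have h2 := finrank_range_coboundary (f * opp E)
  have h3 : Nat.card (E × Bool) = 2 * Nat.card E := by
    rw [Nat.card_prod, mul_comm]
    simp
  rw [commonOrbits_mul_right] at h2
  unfold IsSpherical at hs
  rw [Multigraph.card_cycles_opp] at hs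
  omega

/-- On the sphere a cycle mod 2 is a coboundary of faces. -/
theorem IsSpherical.exists_face_potential [Fintype E] (hs : f.IsSpherical (opp E)) {x : E → ZMod 2}
    (hx : ∀ z : f.Cycles → ZMod 2, ∑ h : E × Bool, z (f.cycleMk h) * x h.1 = 0) :
    ∃ y : E × Bool → ZMod 2, (∀ h, y (f (opp E h)) = y h) ∧ ∀ h, x h.1 = y h + y (opp E h) := by
  have hmem : x ∈ LinearMap.range (f * opp E).coboundary := by
    refine Submodule.mem_of_dotProduct_eq_zero (W := LinearMap.range f.coboundary) ?_
      (by simpa [Nat.card_eq_fintype_card] using hs.card_le_finrank_add) ?_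
    · rintro _ ⟨z, rfl⟩ _ ⟨y, rfl⟩
      exact coboundary_dotProduct_coboundary z y
    · rintro _ ⟨z, rfl⟩
      rw [← hx z, Fintype.sum_prod_type, dotProduct]
      refine Finset.sum_congr rfl fun e _ => ?_
      simp only [Fintype.sum_bool, coboundary, LinearMap.coe_mk, AddHom.coe_mk]
      ring
  obtain ⟨y, rfl⟩ := hmem
  exact ⟨fun h => y ((f * opp E).cycleMk h), fun h => congrArg y ((f * opp E).cycleMk_apply h),
    coboundary_apply _ y⟩

/-- On the sphere a cycle mod 2 of the dual graph is a coboundary of vertices, i.e. a cut. -/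
theorem IsSpherical.exists_vertex_potential [Fintype E] (hs : f.IsSpherical (opp E))
    {x : E → ZMod 2}
    (hx : ∀ y : (f * opp E).Cycles → ZMod 2, x ⬝ᵥ (f * opp E).coboundary y = 0) :
    ∃ z : E × Bool → ZMod 2, (∀ h, z (f h) = z h) ∧ ∀ h, x h.1 = z h + z (opp E h) := by
  have hmem : x ∈ LinearMap.range f.coboundary := by
    refine Submodule.mem_of_dotProduct_eq_zero (W := LinearMap.range (f * opp E).coboundary) ?_
      (by simpa [Nat.card_eq_fintype_card, add_comm] using hs.card_le_finrank_add) ?_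
    · rintro _ ⟨y, rfl⟩ _ ⟨z, rfl⟩
      rw [dotProduct_comm]
      exact coboundary_dotProduct_coboundary z y
    · rintro _ ⟨y, rfl⟩
      rw [dotProduct_comm]
      exact hx y
  obtain ⟨z, rfl⟩ := hmem
  exact ⟨fun h => z (f.cycleMk h), fun h => congrArg z (f.cycleMk_apply h), coboundary_apply _ z⟩

end Equiv.Perm

/-! ### Doubling the edges, and the medial graph. -/

namespace Equiv.Perm

open Multigraph (opp opp_opp)

theorem apply_inv_self {D : Type} (f : Equiv.Perm D) (x : D) : f (f⁻¹ x) = x := by simp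

theorem inv_apply_self {D : Type} (f : Equiv.Perm D) (x : D) : f⁻¹ (f x) = x := by simp

variable {D : Type} {f g : Equiv.Perm D}

theorem cycleMk_inv_apply (f : Equiv.Perm D) (x : D) : f.cycleMk (f⁻¹ x) = f.cycleMk x := by
  rw [← cycleMk_apply f (f⁻¹ x), apply_inv_self]

/-- The rotation at the vertices when every edge is replaced by two parallel edges: the dart `d`
becomes `(d, false)` followed by `(d, true)`. -/
def double (f : Equiv.Perm D) : Equiv.Perm (D × Bool) where
  toFun x := if x.2 then (f x.1, false) else (x.1, true)
  invFun x := if x.2 then (x.1, false) else (f⁻¹ x.1, true)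
  left_inv := by rintro ⟨d, _ | _⟩ <;> simp
  right_inv := by rintro ⟨d, _ | _⟩ <;> simp

@[simp] theorem double_false (d : D) : f.double (d, false) = (d, true) := rfl
@[simp] theorem double_true (d : D) : f.double (d, true) = (f d, false) := rfl

/-- The other halves of the edges when every edge is replaced by two parallel edges. -/
def doubleOpp (g : Equiv.Perm D) : Equiv.Perm (D × Bool) := g.prodCongr Equiv.boolNot

@[simp] theorem doubleOpp_apply (d : D) (b : Bool) : g.doubleOpp (d, b) = (g d, !b) := rfl

/-- Each edge contributes one new edge and one new face, the digon formed by the darts `(d, true)`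
and `(g d, true)`. -/
theorem IsSpherical.double [Finite D] (hs : f.IsSpherical g) (hg : ∀ x, g (g x) = x) :
    f.double.IsSpherical g.doubleOpp := by
  have h1 : Nat.card f.double.Cycles = Nat.card f.Cycles := by
    refine Nat.card_congr ⟨Quot.lift (fun x => f.cycleMk x.1) ?_,
      Quot.lift (fun d => f.double.cycleMk (d, false)) ?_, ?_, ?_⟩
    · rintro ⟨d, _ | _⟩ _ rfl
      · rfl
      · exact (f.cycleMk_apply d).symm
    · rintro d _ rfl
      rw [← double_true, cycleMk_apply, ← double_false (f := f), cycleMk_apply]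
    · rintro ⟨d, _ | _⟩
      · rfl
      · exact Quot.sound rfl
    · rintro ⟨d⟩
      rfl
  have h2 : Nat.card (D × Bool) = 2 * Nat.card g.doubleOpp.Cycles := by
    refine card_eq_two_mul_card_cycles ?_ ?_
    · rintro ⟨d, b⟩
      simp [hg]
    · rintro ⟨d, _ | _⟩ <;> simp
  have h3 : Nat.card (f.double * g.doubleOpp).Cycles =
      Nat.card (f * g).Cycles + Nat.card g.Cycles := by
    rw [← Nat.card_sum]
    refine Nat.card_congr ⟨Quot.lift (fun x => if x.2 then .inr (g.cycleMk x.1)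
      else .inl ((f * g).cycleMk x.1)) ?_, Sum.elim
      (Quot.lift (fun d => (f.double * g.doubleOpp).cycleMk (d, false)) ?_)
      (Quot.lift (fun d => (f.double * g.doubleOpp).cycleMk (d, true)) ?_), ?_, ?_⟩
    · rintro ⟨d, _ | _⟩ _ rfl
      · exact congrArg Sum.inl ((f * g).cycleMk_apply d).symm
      · exact congrArg Sum.inr (g.cycleMk_apply d).symm
    · rintro d _ rfl
      exact Quot.sound rfl
    · rintro d _ rfl
      exact Quot.sound rfl
    · rintro ⟨d, _ | _⟩ <;> rfl
    · rintro (d | d) <;> induction d using Quot.ind <;> rfl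
  have h4 : Nat.card (f.double.CommonOrbits g.doubleOpp) = Nat.card (f.CommonOrbits g) := by
    have key (d : D) (b : Bool) : (Quot.mk _ (d, b) : f.double.CommonOrbits g.doubleOpp) =
        Quot.mk _ (d, false) := by
      cases b
      · rfl
      · exact (Quot.sound (.inl rfl)).symm
    refine Nat.card_congr ⟨Quot.lift (fun x => Quot.mk _ x.1) ?_,
      Quot.lift (fun d => Quot.mk _ (d, false)) ?_, ?_, ?_⟩
    · rintro ⟨d, _ | _⟩ _ (rfl | rfl)
      · rfl
      · exact Quot.sound (.inr rfl)
      · exact Quot.sound (.inl rfl)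
      · exact Quot.sound (.inr rfl)
    · rintro d _ (rfl | rfl)
      · exact (key d true).symm.trans (Quot.sound (.inl rfl))
      · exact (Quot.sound (.inr rfl)).trans (key (g d) true)
    · rintro ⟨d, b⟩
      exact (key d b).symm
    · rintro ⟨d⟩
      rfl
  have h5 : Nat.card (D × Bool) = 2 * Nat.card D := by
    rw [Nat.card_prod, mul_comm]
    simp
  unfold IsSpherical at *
  omega

/-- The rotation of the medial graph, whose edges are the corners: the corner between the darts `d`
and `f d` is called `d`, and its halves are `(d, false)` at the edge of `d` and `(d, true)` at the
edge of `f d`. -/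
def medialRot (f g : Equiv.Perm D) : Equiv.Perm (D × Bool) where
  toFun x := if x.2 then (g (f x.1), false) else (f⁻¹ x.1, true)
  invFun x := if x.2 then (f x.1, false) else (f⁻¹ (g⁻¹ x.1), true)
  left_inv := by rintro ⟨d, _ | _⟩ <;> simp
  right_inv := by rintro ⟨d, _ | _⟩ <;> simp

@[simp] theorem medialRot_false (d : D) : medialRot f g (d, false) = (f⁻¹ d, true) := rfl
@[simp] theorem medialRot_true (d : D) : medialRot f g (d, true) = (g (f d), false) := rfl

/-- Medial vertices are the cycles of `g`. Medial faces are the old vertices (darts `(d, true)`)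
together with the old faces (darts `(d, false)`). -/
theorem IsSpherical.medialRot [Finite D] (hs : f.IsSpherical g) :
    (f.medialRot g).IsSpherical (opp D) := by
  have h1 : Nat.card (f.medialRot g).Cycles = Nat.card g.Cycles := by
    refine Nat.card_congr ⟨Quot.lift (fun x => g.cycleMk (if x.2 then f x.1 else x.1)) ?_,
      Quot.lift (fun d => (f.medialRot g).cycleMk (d, false)) ?_, ?_, ?_⟩
    · rintro ⟨d, _ | _⟩ _ rfl
      · simp
      · exact (g.cycleMk_apply _).symm
    · rintro d _ rfl
      rw [← cycleMk_apply, medialRot_false, ← cycleMk_apply, medialRot_true, apply_inv_self]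
    · rintro ⟨d, _ | _⟩
      · rfl
      · change (f.medialRot g).cycleMk _ = (f.medialRot g).cycleMk _
        rw [if_pos rfl, ← cycleMk_apply, medialRot_false, inv_apply_self]
    · rintro ⟨d⟩
      rfl
  have h3 : Nat.card (f.medialRot g * opp D).Cycles =
      Nat.card f.Cycles + Nat.card (g * f).Cycles := by
    rw [← Nat.card_sum]
    refine Nat.card_congr ⟨Quot.lift (fun x => if x.2 then .inl (f.cycleMk x.1)
      else .inr ((g * f).cycleMk x.1)) ?_, Sum.elim
      (Quot.lift (fun d => (f.medialRot g * opp D).cycleMk (d, true)) ?_)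
      (Quot.lift (fun d => (f.medialRot g * opp D).cycleMk (d, false)) ?_), ?_, ?_⟩
    · rintro ⟨d, _ | _⟩ _ rfl
      · exact congrArg Sum.inr ((g * f).cycleMk_apply d).symm
      · exact congrArg Sum.inl (f.cycleMk_inv_apply d).symm
    · rintro d _ rfl
      refine (Quot.sound ?_).symm
      change (f⁻¹ (f d), true) = (d, true)
      simp
    · rintro d _ rfl
      exact Quot.sound rfl
    · rintro ⟨d, _ | _⟩ <;> rfl
    · rintro (d | d) <;> induction d using Quot.ind <;> rfl
  have h3' : Nat.card (f * g).Cycles = Nat.card (g * f).Cycles :=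
    card_cycles_congr g fun x => by simp
  have h4 : Nat.card ((f.medialRot g).CommonOrbits (opp D)) = Nat.card (f.CommonOrbits g) := by
    have key (d : D) (b : Bool) : (Quot.mk _ (d, b) : (f.medialRot g).CommonOrbits (opp D)) =
        Quot.mk _ (d, false) := by
      cases b
      · rfl
      · exact Quot.sound (.inr rfl)
    have key' (d : D) : (Quot.mk _ (d, false) : (f.medialRot g).CommonOrbits (opp D)) =
        Quot.mk _ (f d, false) := by
      refine Eq.symm ((Quot.sound (.inl rfl)).trans ?_)
      rw [medialRot_false, inv_apply_self, key]
    have hf (d : D) : (Quot.mk _ (f⁻¹ d) : f.CommonOrbits g) = Quot.mk _ d :=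
      Quot.sound (.inl (by simp))
    refine Nat.card_congr ⟨Quot.lift (fun x => Quot.mk _ x.1) ?_,
      Quot.lift (fun d => Quot.mk _ (d, false)) ?_, ?_, ?_⟩
    · rintro ⟨d, _ | _⟩ _ (rfl | rfl)
      · exact (hf d).symm
      · rfl
      · exact (Quot.sound (.inl rfl)).trans (Quot.sound (.inr rfl))
      · rfl
    · rintro d _ (rfl | rfl)
      · exact key' d
      · have : (Quot.mk _ (f⁻¹ d, true) : (f.medialRot g).CommonOrbits (opp D)) =
            Quot.mk _ (g (f (f⁻¹ d)), false) := Quot.sound (.inl rfl)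
        rwa [key, key', apply_inv_self] at this
    · rintro ⟨d, b⟩
      exact (key d b).symm
    · rintro ⟨d⟩
      rfl
  have h5 : Nat.card (D × Bool) = 2 * Nat.card D := by
    rw [Nat.card_prod, mul_comm]
    simp
  unfold IsSpherical at *
  rw [Multigraph.card_cycles_opp]
  omega

/-- The medial graph: its vertices are the edges, its edges are the corners. -/
def medial (f g : Equiv.Perm D) : Multigraph g.Cycles D where
  ends d b := g.cycleMk (if b then f d else d)

theorem medial_base_false (d : D) : (f.medial g).base (d, false) = g.cycleMk d := rfl
theorem medial_base_true (d : D) : (f.medial g).base (d, true) = g.cycleMk (f d) := rfl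

theorem medial_base_medialRot (h : D × Bool) :
    (f.medial g).base (f.medialRot g h) = (f.medial g).base h := by
  rcases h with ⟨d, _ | _⟩
  · rw [medialRot_false, medial_base_true, medial_base_false, apply_inv_self]
  · rw [medialRot_true, medial_base_true, medial_base_false, cycleMk_apply]

/-- The embedding of the medial graph. -/
def medialRotationSystem (f g : Equiv.Perm D) (hg : ∀ x, g (g x) = x) :
    (f.medial g).RotationSystem where
  rot := f.medialRot g
  sameCycle_iff h k := by
    refine ⟨fun H => H.apply_eq medial_base_medialRot, fun H => ?_⟩
    have key (h : D × Bool) : ∃ d, (f.medialRot g).SameCycle (d, false) h := by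
      rcases h with ⟨d, _ | _⟩
      · exact ⟨d, .refl _ _⟩
      · exact ⟨f d, 1, by simp⟩
    obtain ⟨x, hx⟩ := key h
    obtain ⟨y, hy⟩ := key k
    refine hx.symm.trans (.trans ?_ hy)
    rw [← hx.apply_eq medial_base_medialRot, ← hy.apply_eq medial_base_medialRot,
      medial_base_false, medial_base_false, cycleMk_eq_iff_of_involutive hg] at H
    rcases H with rfl | rfl
    · exact .refl _ _
    · exact .symm ⟨2, by simp [zpow_ofNat, pow_two]⟩

theorem medial_isRegular (hg : ∀ x, g (g x) = x) (hg' : ∀ x, g x ≠ x) :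
    (f.medial g).IsRegular 4 := by
  rintro ⟨x⟩
  -- The corners just after and just before the edge, at each of its two ends.
  let s : Fin 4 → D × Bool := ![(x, false), (g x, false), (f⁻¹ x, true), (f⁻¹ (g x), true)]
  have hs : Function.Injective s := by
    have := hg' x
    have := (hg' x).symm
    intro i j
    fin_cases i <;> fin_cases j <;> simp [s, *]
  have hrange : {h | (f.medial g).base h = g.cycleMk x} = Set.range s := by
    ext ⟨d, _ | _⟩
    · rw [Set.mem_ofPred_eq, medial_base_false, cycleMk_eq_iff_of_involutive hg]
      simp [s, eq_comm, or_comm]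
    · rw [Set.mem_ofPred_eq, medial_base_true, cycleMk_eq_iff_of_involutive hg, ← eq_inv_iff_eq,
        ← eq_inv_iff_eq]
      simp [s, eq_comm, or_comm]
  have : (f.medial g).degree (g.cycleMk x) = Nat.card (Set.range s) := by
    rw [← hrange]
    rfl
  rw [Multigraph.degree] at this ⊢
  rw [this, Nat.card_range_of_injective hs]
  simp

theorem _root_.Multigraph.Adj.symm {V E : Type} {G : Multigraph V E} {u w : V} (h : G.Adj u w) :
    G.Adj w u := by
  obtain ⟨h, rfl, rfl⟩ := h
  exact ⟨opp E h, rfl, by rw [opp_opp]⟩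

theorem _root_.Multigraph.ReachableAvoiding.symm {V E : Type} {G : Multigraph V E} {v u w : V}
    (h : G.ReachableAvoiding v u w) : G.ReachableAvoiding v w u :=
  haveI : Std.Symm fun a b => G.Adj a b ∧ a ≠ v ∧ b ≠ v := ⟨fun _ _ h => ⟨h.1.symm, h.2.2, h.2.1⟩⟩
  Std.Symm.symm (r := Relation.ReflTransGen _) _ _ h

/-- A vertex all of whose neighbours can be joined without it is not a cut-vertex. -/
theorem _root_.Multigraph.not_isCutVertex {V E : Type} {G : Multigraph V E} {v t : V}
    (h : ∀ w, w ≠ v → G.Adj v w → G.ReachableAvoiding v t w) : ¬ G.IsCutVertex v := by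
  rintro ⟨u, w, hu, hw, huw, hn⟩
  have key (w) (H : G.Reachable u w) :
      (w ≠ v → G.ReachableAvoiding v u w) ∧ (w = v → G.ReachableAvoiding v u t) := by
    induction H with
    | refl => exact ⟨fun _ => .refl, fun h => absurd h hu⟩
    | @tail b c _ hbc ih =>
      by_cases hb : b = v
      · subst hb
        refine ⟨fun hc => (ih.2 rfl).trans (h c hc hbc), fun _ => ih.2 rfl⟩
      · refine ⟨fun hc => (ih.1 hb).tail ⟨hbc, hb, hc⟩, fun hc => ?_⟩
        subst hc
        exact (ih.1 hb).trans (h b hb hbc.symm).symm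
  exact hn ((key w huw).1 hw)

/-- All edges at a vertex of a loopless graph except one are joined in the medial graph without
that one. -/
theorem medial_reachableAvoiding (hg : ∀ x, g (g x) = x)
    (hl : ∀ x, f.cycleMk (g x) ≠ f.cycleMk x) [Finite D] {x y : D}
    (hxy : f.cycleMk x = f.cycleMk y) (hne : y ≠ x) :
    (f.medial g).ReachableAvoiding (g.cycleMk x) (g.cycleMk (f x)) (g.cycleMk y) := by
  obtain ⟨n, -, rfl⟩ := (cycleMk_eq_iff.1 hxy).exists_pow_eq'
  -- A dart at this vertex other than `x` is not on the deleted edge, since `g x` lies at another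
  -- vertex.
  have key (m : ℕ) (hm : (f ^ m) x ≠ x) : g.cycleMk ((f ^ m) x) ≠ g.cycleMk x := by
    rw [ne_eq, cycleMk_eq_iff_of_involutive hg, not_or]
    refine ⟨hm, fun h => hl x ?_⟩
    rw [← h, cycleMk_eq_iff]
    exact .symm ⟨m, by simp⟩
  induction n with
  | zero => exact absurd rfl hne
  | succ n ih =>
    -- If the rotation has just returned to `x`, the next dart is `f x` and the walk starts afresh.
    by_cases hn : (f ^ n) x = x
    · rw [pow_succ', mul_apply, hn]
      exact .refl
    · refine (ih (by rw [cycleMk_eq_iff]; exact ⟨n, by simp⟩) hn).tail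
        ⟨⟨((f ^ n) x, false), rfl, ?_⟩, key n hn, key _ hne⟩
      rw [pow_succ', mul_apply]
      rfl

/-- At each end of the edge of `x` the remaining edges are chained by corners. By `hx` the edge
following `x` at one end is the edge preceding `g x` at the other, so the two chains meet. In a
doubled graph the parallel edge plays this role. -/
theorem medial_not_isCutVertex [Finite D] (hg : ∀ x, g (g x) = x)
    (hl : ∀ x, f.cycleMk (g x) ≠ f.cycleMk x) {x : D}
    (hx : g.cycleMk (f x) = g.cycleMk (f⁻¹ (g x))) : ¬ (f.medial g).IsCutVertex (g.cycleMk x) := by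
  refine Multigraph.not_isCutVertex (t := g.cycleMk (f x)) ?_
  have h1 (y : D) (hy : f.cycleMk x = f.cycleMk y) (hne : g.cycleMk y ≠ g.cycleMk x) :
      (f.medial g).ReachableAvoiding (g.cycleMk x) (g.cycleMk (f x)) (g.cycleMk y) :=
    medial_reachableAvoiding hg hl hy fun h => hne (by rw [h])
  have h2 (y : D) (hy : f.cycleMk (g x) = f.cycleMk y) (hne : g.cycleMk y ≠ g.cycleMk x) :
      (f.medial g).ReachableAvoiding (g.cycleMk x) (g.cycleMk (f x)) (g.cycleMk y) := by
    have key (z : D) (hz : f.cycleMk (g x) = f.cycleMk z) (hne : z ≠ g x) :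
        (f.medial g).ReachableAvoiding (g.cycleMk x) (g.cycleMk (f (g x))) (g.cycleMk z) := by
      rw [← cycleMk_apply g x]
      exact medial_reachableAvoiding hg hl hz hne
    rw [hx]
    -- If `g x` is alone at its vertex, there is no other edge to reach at that end.
    by_cases hfix : f (g x) = g x
    · rw [← (cycleMk_eq_iff.1 hy).eq_of_left hfix, cycleMk_apply] at hne
      exact absurd rfl hne
    · refine (key _ (cycleMk_inv_apply _ _).symm fun h => hfix ?_).symm.trans
        (key y hy fun h => hne (by rw [h, cycleMk_apply]))
      rw [inv_eq_iff_eq] at h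
      exact h.symm
  rintro _ hw ⟨⟨d, _ | _⟩, h, rfl⟩
  · change g.cycleMk (f d) ≠ _ at hw
    change (f.medial g).ReachableAvoiding _ _ (g.cycleMk (f d))
    rcases (cycleMk_eq_iff_of_involutive hg).1 h with rfl | rfl
    · exact h1 _ (cycleMk_apply _ _).symm hw
    · exact h2 _ (cycleMk_apply _ _).symm hw
  · change g.cycleMk d ≠ _ at hw
    change (f.medial g).ReachableAvoiding _ _ (g.cycleMk d)
    rw [medial_base_true] at h
    rcases (cycleMk_eq_iff_of_involutive hg).1 h with h | h
    · exact h1 _ (by rw [← h, cycleMk_apply]) hw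
    · exact h2 _ (by rw [← h, cycleMk_apply]) hw

/-- The vertex-orientation of the medial graph in which both edge cells at the edge `e` contain
corners at both ends of `e`. -/
def medialOrientation (f g : Equiv.Perm D) (v : g.Cycles) : Set (Set (D × Bool)) :=
  {c | ∃ d, g.cycleMk (f d) = v ∧ c = {(d, true), (g (f d), false)}}

theorem isVertexOrientation_medialOrientation (hg : ∀ x, g (g x) = x) :
    (f.medialRotationSystem g hg).IsVertexOrientation (f.medialOrientation g) where
  consecutive := by
    rintro v c ⟨d, hd, rfl⟩
    exact ⟨(d, true), hd, rfl⟩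
  partition := by
    rintro ⟨d, _ | _⟩
    · refine ⟨{(f⁻¹ (g d), true), (d, false)}, ⟨⟨f⁻¹ (g d), ?_, ?_⟩, by simp⟩, ?_⟩
      · rw [apply_inv_self, cycleMk_apply]
        rfl
      · rw [apply_inv_self, hg]
      · rintro _ ⟨⟨d', -, rfl⟩, h⟩
        obtain rfl : d = g (f d') := by simpa using h
        rw [hg, inv_apply_self]
    · refine ⟨{(d, true), (g (f d), false)}, ⟨⟨d, rfl, rfl⟩, by simp⟩, ?_⟩
      rintro _ ⟨⟨d', -, rfl⟩, h⟩
      obtain rfl : d = d' := by simpa using h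
      rfl

/-- A cell has one corner at each end of its edge; if both were halves of one corner, the edge would
be a loop. -/
theorem isTransverseAt_medialOrientation
    (hl : ∀ x, f.cycleMk (g x) ≠ f.cycleMk x) (v : g.Cycles) :
    Multigraph.IsTransverseAt (f.medialOrientation g) v := by
  rintro e ⟨d, -, h⟩
  have h1 : ((e, true) : D × Bool) ∈ ({(d, true), (g (f d), false)} : Set _) := by simp [← h]
  have h2 : ((e, false) : D × Bool) ∈ ({(d, true), (g (f d), false)} : Set _) := by simp [← h]
  obtain rfl : e = d := by simpa using h1
  have h3 : e = g (f e) := by simpa using h2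
  apply hl (f e)
  rw [← h3, cycleMk_apply]

/-- The first coordinate of a bijection from three colours to the non-zero elements of `𝔽₂²`. -/
def colourFst : Fin 3 → ZMod 2 := ![0, 1, 1]

/-- The second coordinate of a bijection from three colours to the non-zero elements of `𝔽₂²`. -/
def colourSnd : Fin 3 → ZMod 2 := ![1, 0, 1]

theorem colour_ext : ∀ i j, i ≠ j →
    (colourFst i + colourFst j, colourSnd i + colourSnd j) ≠ ((0, 0) : ZMod 2 × ZMod 2) := by
  decide

variable {ε : D → Fin 3}

theorem medial_colour_ne (hε : (f.medial g).IsOColouring (f.medialOrientation g) ε) (d : D) :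
    ε d ≠ ε (g (f d)) := by
  intro h
  obtain ⟨h1, h2⟩ := hε (g.cycleMk (f d))
  have : (f.medial g).coloursAt ε (g.cycleMk (f d)) ⊆ {ε d} := by
    intro x hx
    obtain ⟨k, hk, rfl⟩ := h2 _ ⟨d, rfl, rfl⟩ x hx
    rcases hk with rfl | rfl
    · rfl
    · exact h.symm
  have := Set.ncard_le_ncard this
  rw [Set.ncard_singleton] at this
  omega

/-- Every cell at a medial vertex carries the same two distinct colours, once each. This makes the
colour sum at the vertex zero mod 2. -/
theorem medial_colour_sum (hε : (f.medial g).IsOColouring (f.medialOrientation g) ε) {d d' : D}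
    (h : g.cycleMk (f d) = g.cycleMk (f d')) (t : Fin 3 → ZMod 2) :
    t (ε d) + t (ε (g (f d))) = t (ε d') + t (ε (g (f d'))) := by
  have key {d d' : D} (h : g.cycleMk (f d) = g.cycleMk (f d')) :
      (ε d = ε d' ∨ ε d = ε (g (f d'))) ∧
        (ε (g (f d)) = ε d' ∨ ε (g (f d)) = ε (g (f d'))) := by
    have h2 := (hε (g.cycleMk (f d'))).2 _ ⟨d', rfl, rfl⟩
    constructor
    · obtain ⟨k, hk, hk'⟩ := h2 (ε d) ⟨(d, true), h, rfl⟩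
      rcases hk with rfl | rfl
      · exact .inl hk'.symm
      · exact .inr hk'.symm
    · obtain ⟨k, hk, hk'⟩ := h2 (ε (g (f d))) ⟨(g (f d), false),
        by rw [medial_base_false, cycleMk_apply, h], rfl⟩
      rcases hk with rfl | rfl
      · exact .inl hk'.symm
      · exact .inr hk'.symm
  have hne := medial_colour_ne hε d
  obtain ⟨h1 | h1, h2 | h2⟩ := key h
  · exact absurd (h1.trans h2.symm) hne
  · rw [h1, h2]
  · rw [h1, h2, add_comm]
  · exact absurd (h1.trans h2.symm) hne

/-- The colours of an o-colouring of the medial graph are the differences of a potential on the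
vertices and faces. -/
theorem medial_exists_potential [Finite D] (hg : ∀ x, g (g x) = x) (hg' : ∀ x, g x ≠ x)
    (hs : f.IsSpherical g)
    (hε : (f.medial g).IsOColouring (f.medialOrientation g) ε) (t : Fin 3 → ZMod 2) :
    ∃ y : D → ZMod 2, (∀ x, y (f x) = y x) ∧
      ∀ d, y (g (f d)) + y (f d) = t (ε d) + t (ε (g (f d))) := by
  have := Fintype.ofFinite D
  obtain ⟨y, hy, hy'⟩ := hs.medialRot.exists_face_potential (x := fun d => t (ε d)) (by
    intro z
    -- Reindexing by `g * f` collects the two halves of each cell into one summand.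
    have h1 : ∑ d, z ((f.medialRot g).cycleMk (d, false)) * t (ε d) =
        ∑ d, z ((f.medialRot g).cycleMk (d, true)) * t (ε (g (f d))) := by
      rw [← Equiv.sum_comp (g * f)]
      refine Finset.sum_congr rfl fun d _ => ?_
      rw [mul_apply, ← medialRot_true, cycleMk_apply]
    rw [Fintype.sum_prod_type]
    simp only [Fintype.sum_bool, Finset.sum_add_distrib, h1]
    rw [← Finset.sum_add_distrib]
    simp only [← mul_add]
    -- This involution exchanges the two cells at a medial vertex.
    refine Finset.sum_involution (fun d _ => f⁻¹ (g (f d))) ?_ ?_ ?_ ?_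
    · intro d _
      have h2 : (f.medialRot g).cycleMk (f⁻¹ (g (f d)), true) = (f.medialRot g).cycleMk (d, true) := by
        rw [← medialRot_false (g := g), cycleMk_apply, ← medialRot_true, cycleMk_apply]
      rw [h2, medial_colour_sum hε (d := d) (d' := f⁻¹ (g (f d)))
        (by rw [apply_inv_self, cycleMk_apply]),
        CharTwo.add_self_eq_zero]
    · intro d _ _ h
      exact hg' (f d) (by rw [inv_eq_iff_eq] at h; exact h)
    · simp
    · intro d _
      simp [hg])
  -- On darts `(d, true)` the potential lives on the old vertices, on darts `(d, false)` on the old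
  -- faces; the latter cancels in the sum over a cell.
  have hy1 (d) : y (f⁻¹ d, true) = y (d, true) := hy (d, true)
  have hy2 (d) : y (g (f d), false) = y (d, false) := hy (d, false)
  have hy3 (d) : y (f d, true) = y (d, true) := by rw [← hy1 (f d), inv_apply_self]
  refine ⟨fun d => y (d, true), hy3, fun d => ?_⟩
  have e1 : t (ε d) = y (d, false) + y (d, true) := hy' (d, false)
  have e2 : t (ε (g (f d))) = y (g (f d), false) + y (g (f d), true) := hy' (g (f d), false)
  change y (g (f d), true) + y (f d, true) = _
  rw [e1, e2, hy2, hy3]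
  have := CharTwo.add_self_eq_zero (y (d, false))
  linear_combination -this

end Equiv.Perm

/-! ### From o-colourings to four colours. -/

/-- The assertion on o-colourings implies that loopless spherical pairs of permutations can be
four-coloured. -/
theorem exists_colouring_of_oColouring
    (H : ∀ (V E : Type) [Finite V] [Finite E] (G : Multigraph V E) (R : G.RotationSystem),
      R.IsPlane → G.IsRegular 4 → (∀ v, ¬ G.IsCutVertex v) →
      ∀ σ : V → Set (Set (E × Bool)), R.IsVertexOrientation σ →
        (∀ v, G.IsLoopAnchor v → Multigraph.IsTransverseAt σ v) → G.IsOColourable 3 σ)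
    {D : Type} [Finite D] {f g : Equiv.Perm D} (hg : ∀ x, g (g x) = x)
    (hs : f.IsSpherical g) (hl : ∀ x, f.cycleMk (g x) ≠ f.cycleMk x) :
    ∃ c : D → ZMod 2 × ZMod 2, (∀ x, c (f x) = c x) ∧ ∀ x, c (g x) ≠ c x := by
  have hs2 := hs.double hg
  have hg2 : ∀ x, g.doubleOpp (g.doubleOpp x) = x := by
    rintro ⟨d, b⟩
    simp [hg]
  have hg2' : ∀ x, g.doubleOpp x ≠ x := by
    rintro ⟨d, _ | _⟩ <;> simp
  have hl2 : ∀ x, f.double.cycleMk (g.doubleOpp x) ≠ f.double.cycleMk x := by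
    rintro ⟨d, b⟩ h
    refine hl d ((Equiv.Perm.cycleMk_eq_iff.1 h).apply_eq (c := fun x => f.cycleMk x.1) ?_)
    rintro ⟨d, _ | _⟩
    · rfl
    · exact f.cycleMk_apply d
  obtain ⟨ε, hε⟩ := H _ _ (f.double.medial g.doubleOpp) (f.double.medialRotationSystem _ hg2)
    ((Multigraph.RotationSystem.isPlane_iff _).2 hs2.medialRot)
    (Equiv.Perm.medial_isRegular hg2 hg2')
    (by
      rintro ⟨x⟩
      -- Every doubled edge has a dart of the form `(d, false)`, and `(d, true)` follows it on the
      -- parallel edge.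
      have key (d : D) :
          ¬ (f.double.medial g.doubleOpp).IsCutVertex (g.doubleOpp.cycleMk (d, false)) := by
        refine Equiv.Perm.medial_not_isCutVertex hg2 hl2 ?_
        rw [Equiv.Perm.double_false, Equiv.Perm.doubleOpp_apply, ← Equiv.Perm.cycleMk_apply]
        rfl
      rcases x with ⟨d, _ | _⟩
      · exact key d
      · have := key (g d)
        rwa [← Equiv.Perm.cycleMk_apply, Equiv.Perm.doubleOpp_apply, hg] at this)
    _ (Equiv.Perm.isVertexOrientation_medialOrientation hg2)
    (fun v _ => Equiv.Perm.isTransverseAt_medialOrientation hl2 v)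
  obtain ⟨y, hy, hy'⟩ :=
    Equiv.Perm.medial_exists_potential hg2 hg2' hs2 hε Equiv.Perm.colourFst
  obtain ⟨z, hz, hz'⟩ :=
    Equiv.Perm.medial_exists_potential hg2 hg2' hs2 hε Equiv.Perm.colourSnd
  have hpair (b : Bool) (d : D) : (y (d, b), z (d, b)) = (y (d, false), z (d, false)) := by
    cases b
    · rfl
    · rw [← Equiv.Perm.double_false (f := f), hy, hz]
  refine ⟨fun d => (y (d, false), z (d, false)), fun d => ?_, fun d h => ?_⟩
  · dsimp only
    rw [← Equiv.Perm.double_true, hy, hz, hpair]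
  · obtain ⟨x, hx⟩ := f.double.surjective (d, false)
    refine Equiv.Perm.colour_ext _ _ (Equiv.Perm.medial_colour_ne hε x) ?_
    rw [← hy', ← hz', hx, Equiv.Perm.doubleOpp_apply]
    have h' := (hpair (!false) (g d)).trans h
    rw [Prod.mk.injEq] at h' ⊢
    rw [h'.1, h'.2]
    exact ⟨CharTwo.add_self_eq_zero _, CharTwo.add_self_eq_zero _⟩

/-- The assertion on o-colourings implies the four colour theorem. -/
theorem fourColourTheorem_of_oColouring
    (H : ∀ (V E : Type) [Finite V] [Finite E] (G : Multigraph V E) (R : G.RotationSystem),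
      R.IsPlane → G.IsRegular 4 → (∀ v, ¬ G.IsCutVertex v) →
      ∀ σ : V → Set (Set (E × Bool)), R.IsVertexOrientation σ →
        (∀ v, G.IsLoopAnchor v → Multigraph.IsTransverseAt σ v) → G.IsOColourable 3 σ) :
    FourColourTheorem := by
  rintro V E _ _ G hloop ⟨R, hR⟩
  obtain ⟨c, hc, hc'⟩ := exists_colouring_of_oColouring H Multigraph.opp_opp
    (R.isPlane_iff.1 hR) (by
      intro h
      rw [ne_eq, Equiv.Perm.cycleMk_eq_iff, R.sameCycle_iff]
      rcases h with ⟨e, _ | _⟩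
      · exact (hloop e).symm
      · exact hloop e)
  classical
  -- Isolated vertices carry no dart and may have any colour.
  let q : V → ZMod 2 × ZMod 2 := fun v => if h : ∃ k, G.base k = v then c h.choose else 0
  have hq (h : E × Bool) : q (G.base h) = c h := by
    have hex : ∃ k, G.base k = G.base h := ⟨h, rfl⟩
    simp only [q, dif_pos hex]
    exact ((R.sameCycle_iff _ _).2 hex.choose_spec).apply_eq hc
  have hcard : Fintype.card (ZMod 2 × ZMod 2) = 4 := rfl
  refine ⟨fun v => Fintype.equivFinOfCardEq hcard (q v), fun e h => ?_⟩
  rw [(Fintype.equivFinOfCardEq hcard).apply_eq_iff_eq] at h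
  have := hc' (e, false)
  rw [← hq, ← hq] at this
  exact this h.symm

/-! ### The dual graph with one diagonal in each quadrangle. -/

namespace Equiv.Perm

open Multigraph (opp opp_opp)

variable {D : Type} {f g : Equiv.Perm D} {S : Set D}

open Classical in
/-- The dual rotation, with a further dart inserted before each dart in `S`. -/
noncomputable def diagonalRot (f g : Equiv.Perm D) (S : Set D) : Equiv.Perm (D ⊕ S) where
  toFun := Sum.elim (fun x => if h : f (g x) ∈ S then .inr ⟨_, h⟩ else .inl (f (g x)))
    fun s => .inl s
  invFun := Sum.elim (fun x => if h : x ∈ S then .inr ⟨_, h⟩ else .inl (g⁻¹ (f⁻¹ x)))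
    fun s => .inl (g⁻¹ (f⁻¹ s))
  left_inv := by
    rintro (x | s)
    · by_cases h : f (g x) ∈ S <;> simp [h]
    · simp
  right_inv := by
    rintro (x | s)
    · by_cases h : x ∈ S <;> simp [h]
    · simp

theorem diagonalRot_inl_of_mem {x : D} (h : f (g x) ∈ S) :
    diagonalRot f g S (.inl x) = .inr ⟨_, h⟩ := dif_pos h

theorem diagonalRot_inl_of_notMem {x : D} (h : f (g x) ∉ S) :
    diagonalRot f g S (.inl x) = .inl (f (g x)) := dif_neg h

/-- The half turn on `S`. -/
def halfTurn (hf : ∀ x, f (f (f (f x))) = x) (hS : ∀ x, f x ∈ S ↔ x ∉ S) : Equiv.Perm S where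
  toFun s := ⟨f (f s), by rw [hS, hS, not_not]; exact s.2⟩
  invFun s := ⟨f (f s), by rw [hS, hS, not_not]; exact s.2⟩
  left_inv s := Subtype.ext (hf s)
  right_inv s := Subtype.ext (hf s)

/-- Each cycle of `f` meets `S` in a single orbit of the half turn, which has two elements. -/
theorem card_eq_two_mul_card_cycles_of_alternating (hf : ∀ x, f (f (f (f x))) = x)
    (hf' : ∀ x, f (f x) ≠ x) (hS : ∀ x, f x ∈ S ↔ x ∉ S) :
    Nat.card S = 2 * Nat.card f.Cycles := by
  classical
  rw [card_eq_two_mul_card_cycles (g := halfTurn hf hS) (fun s => Subtype.ext (hf s))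
    fun s h => hf' s (congrArg Subtype.val h)]
  congr 1
  refine Nat.card_congr ⟨Quot.lift (fun s => f.cycleMk s) ?_, Quot.lift (fun x =>
    if h : x ∈ S then (halfTurn hf hS).cycleMk ⟨x, h⟩
    else (halfTurn hf hS).cycleMk ⟨f x, (hS x).2 h⟩) ?_, ?_, ?_⟩
  · rintro s _ rfl
    change f.cycleMk s = f.cycleMk (f (f s))
    rw [cycleMk_apply, cycleMk_apply]
  · rintro x _ rfl
    by_cases h : x ∈ S
    · have h' : f x ∉ S := by rw [hS, not_not]; exact h
      rw [dif_pos h, dif_neg h']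
      exact Quot.sound rfl
    · rw [dif_neg h, dif_pos ((hS x).2 h)]
  · rintro ⟨s⟩
    exact dif_pos s.2
  · rintro ⟨x⟩
    by_cases h : x ∈ S
    · simp only [dif_pos h]
    · simp only [dif_neg h]
      exact f.cycleMk_apply x

/-- Each diagonal adds one edge and one face, since it cuts a quadrangle into two triangles; the
vertices and components are unchanged. -/
theorem IsSpherical.diagonalRot [Finite D] (hs : f.IsSpherical g) (hg : ∀ x, g (g x) = x)
    (hg' : ∀ x, g x ≠ x) (hf : ∀ x, f (f (f (f x))) = x) (hf' : ∀ x, f (f x) ≠ x)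
    (hS : ∀ x, f x ∈ S ↔ x ∉ S) :
    (diagonalRot f g S).IsSpherical (g.sumCongr (halfTurn hf hS)) := by
  classical
  set r := Equiv.Perm.diagonalRot f g S with hr
  set o : Equiv.Perm (D ⊕ S) := g.sumCongr (halfTurn hf hS) with ho
  have r_inl (x : D) : r.cycleMk (.inl (f (g x))) = r.cycleMk (.inl x) := by
    rw [← cycleMk_apply r (.inl x)]
    by_cases h : f (g x) ∈ S
    · rw [hr, diagonalRot_inl_of_mem h]
      exact cycleMk_apply (f.diagonalRot g S) (Sum.inr ⟨f (g x), h⟩)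
    · rw [hr, diagonalRot_inl_of_notMem h]
  have h1 : Nat.card r.Cycles = Nat.card (f * g).Cycles := by
    refine Nat.card_congr ⟨Quot.lift (Sum.elim (f * g).cycleMk fun s => (f * g).cycleMk s) ?_,
      Quot.lift (fun x => r.cycleMk (.inl x)) ?_, ?_, ?_⟩
    · rintro (x | s) _ rfl
      · by_cases h : f (g x) ∈ S
        · rw [hr, diagonalRot_inl_of_mem h]
          exact ((f * g).cycleMk_apply x).symm
        · rw [hr, diagonalRot_inl_of_notMem h]
          exact ((f * g).cycleMk_apply x).symm
      · rfl
    · rintro x _ rfl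
      exact (r_inl x).symm
    · rintro ⟨x | s⟩
      · rfl
      · exact r.cycleMk_apply (.inr s)
    · rintro x
      induction x using Quot.ind
      rfl
  have h2 : Nat.card (D ⊕ S) = 2 * Nat.card o.Cycles := by
    refine card_eq_two_mul_card_cycles ?_ ?_
    · rintro (x | s)
      · exact congrArg Sum.inl (hg x)
      · exact congrArg Sum.inr (Subtype.ext (hf s))
    · rintro (x | s) h
      · exact hg' x (Sum.inl_injective h)
      · exact hf' s (congrArg Subtype.val (Sum.inr_injective h))
  have ro_inl (x : D) : (r * o) (.inl x) = r (.inl (g x)) := rfl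
  have ro_inr (s : S) : (r * o) (.inr s) = .inl (f (f s)) := rfl
  have h3 : Nat.card (r * o).Cycles = Nat.card S := by
    -- The triangles are `s`, `f s` and the new dart at `f (f s)`, one for each `s ∈ S`. For `x ∉ S`
    -- the representative is `f⁻¹ x`, that is `f (f (f x))`.
    refine Nat.card_congr ⟨Quot.lift (Sum.elim (fun x => if h : x ∈ S then ⟨x, h⟩
      else ⟨f (f (f x)), by rwa [hS, hS, hS, not_not]⟩) fun s => halfTurn hf hS s) ?_,
      fun s => (r * o).cycleMk (.inl s), ?_, ?_⟩
    · rintro (x | s) _ rfl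
      · by_cases h : x ∈ S
        · have h' : f x ∉ S := by rw [hS, not_not]; exact h
          rw [ro_inl, hr, diagonalRot_inl_of_notMem (by rwa [hg])]
          simp [h, h', hg, hf]
        · have h' : f x ∈ S := (hS x).2 h
          rw [ro_inl, hr, diagonalRot_inl_of_mem (by rwa [hg])]
          simp [h, hg, halfTurn]
      · have h' : f (f s) ∈ S := by rw [hS, hS, not_not]; exact s.2
        rw [ro_inr]
        simp [h', halfTurn]
    · have key (s : S) : (r * o).cycleMk (.inl s.1) = (r * o).cycleMk (.inl (f s)) := by
        rw [← cycleMk_apply _ (Sum.inl s.1), ro_inl, hr, diagonalRot_inl_of_notMem, hg]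
        rw [hg, hS, not_not]
        exact s.2
      have key' (s : S) : (r * o).cycleMk (.inr s) = (r * o).cycleMk (.inl (halfTurn hf hS s).1) := by
        rw [← cycleMk_apply _ (Sum.inr s), ro_inr]
        rfl
      rintro ⟨x | s⟩
      · by_cases h : x ∈ S
        · simp only [Sum.elim_inl, dif_pos h]
        · simp only [Sum.elim_inl, dif_neg h]
          refine (key ⟨f (f (f x)), by rwa [hS, hS, hS, not_not]⟩).trans ?_
          simp only [hf]
      · exact (key' s).symm
    · intro s
      exact dif_pos s.2
  have h4 : Nat.card (r.CommonOrbits o) = Nat.card (f.CommonOrbits g) := by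
    have mk_r {x y} (h : r.cycleMk x = r.cycleMk y) : (Quot.mk _ x : r.CommonOrbits o) = Quot.mk _ y :=
      (cycleMk_eq_iff.1 h).apply_eq fun z => (Quot.sound (.inl rfl)).symm
    have mk_f (x) : (Quot.mk _ (f x) : f.CommonOrbits g) = Quot.mk _ x :=
      (Quot.sound (.inl rfl)).symm
    have mk_g (x) : (Quot.mk _ (g x) : f.CommonOrbits g) = Quot.mk _ x :=
      (Quot.sound (.inr rfl)).symm
    refine Nat.card_congr ⟨Quot.lift (Sum.elim (fun x => Quot.mk _ x) fun s => Quot.mk _ s.1) ?_,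
      Quot.lift (fun x => Quot.mk _ (.inl x)) ?_, ?_, ?_⟩
    · rintro (x | s) _ (rfl | rfl)
      · by_cases h : f (g x) ∈ S
        · rw [hr, diagonalRot_inl_of_mem h]
          exact ((mk_f _).trans (mk_g _)).symm
        · rw [hr, diagonalRot_inl_of_notMem h]
          exact ((mk_f _).trans (mk_g _)).symm
      · exact (mk_g _).symm
      · rfl
      · exact ((mk_f _).trans (mk_f _)).symm
    · rintro x _ (rfl | rfl)
      · refine (Quot.sound (.inr rfl) : _ = Quot.mk _ (.inl (g x))).trans ?_
        refine (mk_r (r_inl (g x))).symm.trans ?_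
        rw [hg]
      · exact Quot.sound (.inr rfl)
    · rintro ⟨x | s⟩
      · rfl
      · exact mk_r (r.cycleMk_apply (.inr s))
    · rintro ⟨x⟩
      rfl
  have h5 := card_eq_two_mul_card_cycles_of_alternating hf hf' hS
  have h6 := card_eq_two_mul_card_cycles hg hg'
  rw [Nat.card_sum] at h2
  unfold IsSpherical at *
  rw [h1, h3, h4, Nat.card_sum]
  omega

end Equiv.Perm

/-- Four colours for the faces of a 4-regular plane graph such that adjacent faces have different
colours and so do, at each vertex, the two opposite faces that are at the corners ending in `S`. -/
theorem FourColourTheorem.exists_face_colouring (H : FourColourTheorem) {D : Type} [Finite D]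
    {f g : Equiv.Perm D} {S : Set D} (hs : f.IsSpherical g) (hg : ∀ x, g (g x) = x)
    (hg' : ∀ x, g x ≠ x) (hf : ∀ x, f (f (f (f x))) = x) (hf' : ∀ x, f (f x) ≠ x)
    (hS : ∀ x, f x ∈ S ↔ x ∉ S) (hl : ∀ x, (f * g).cycleMk (g x) ≠ (f * g).cycleMk x)
    (hl' : ∀ x ∈ S, (f * g).cycleMk (f (f x)) ≠ (f * g).cycleMk x) :
    ∃ c : D → Fin 4, (∀ x, c (f (g x)) = c x) ∧ (∀ x, c (g x) ≠ c x) ∧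
      ∀ x ∈ S, c (f (f x)) ≠ c x := by
  let p : D ⊕ S → (f * g).Cycles := Sum.elim (f * g).cycleMk fun s => (f * g).cycleMk s
  have hp (x) : p (f.diagonalRot g S x) = p x := by
    rcases x with x | s
    · by_cases h : f (g x) ∈ S
      · rw [Equiv.Perm.diagonalRot_inl_of_mem h]
        exact (f * g).cycleMk_apply x
      · rw [Equiv.Perm.diagonalRot_inl_of_notMem h]
        exact (f * g).cycleMk_apply x
    · rfl
  obtain ⟨c, hc, hc'⟩ := H.exists_colouring_of_isSpherical
    (g := g.sumCongr (Equiv.Perm.halfTurn hf hS)) (by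
      rintro (x | s)
      · exact congrArg Sum.inl (hg x)
      · exact congrArg Sum.inr (Subtype.ext (hf s))) (by
      rintro (x | s) h
      · exact hg' x (Sum.inl_injective h)
      · exact hf' s (congrArg Subtype.val (Sum.inr_injective h)))
    (hs.diagonalRot hg hg' hf hf' hS) (by
      intro x h
      have := (Equiv.Perm.cycleMk_eq_iff.1 h).apply_eq hp
      rcases x with x | s
      · exact hl x this
      · exact hl' s s.2 this)
  have hc1 (s : S) : c (.inr s) = c (.inl s.1) := (hc (.inr s)).symm
  refine ⟨fun x => c (.inl x), fun x => ?_, fun x => hc' (.inl x), fun x hx => ?_⟩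
  · refine Eq.trans ?_ (hc (.inl x))
    by_cases h : f (g x) ∈ S
    · rw [Equiv.Perm.diagonalRot_inl_of_mem h, hc1]
    · rw [Equiv.Perm.diagonalRot_inl_of_notMem h]
  · have := hc' (.inr ⟨x, hx⟩)
    change c (.inr _) ≠ _ at this
    rw [hc1, hc1] at this
    exact this

/-! ### 4-regular plane graphs: bridges, cut-vertices and cells. -/

namespace Multigraph

open Equiv.Perm (cycleMk_eq_iff cycleMk_apply)

variable {V E : Type} {G : Multigraph V E}

theorem RotationSystem.base_rot (R : G.RotationSystem) (h : E × Bool) :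
    G.base (R.rot h) = G.base h :=
  ((R.sameCycle_iff _ _).1 ⟨1, by simp⟩).symm

theorem RotationSystem.apply_eq {β : Type} (R : G.RotationSystem) {z : E × Bool → β}
    (hz : ∀ h, z (R.rot h) = z h) {h k : E × Bool} (H : G.base h = G.base k) : z h = z k :=
  ((R.sameCycle_iff _ _).2 H).apply_eq hz

theorem RotationSystem.minimalPeriod_rot [Finite E] (R : G.RotationSystem) (h : E × Bool) :
    Function.minimalPeriod R.rot h = G.degree (G.base h) := by
  set p := Function.minimalPeriod R.rot h with hp
  have hbase (n : ℕ) : G.base (R.rot^[n] h) = G.base h := by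
    induction n with
    | zero => rfl
    | succ n ih => rw [Function.iterate_succ_apply', R.base_rot, ih]
  have hb : Function.Bijective
      (fun i : Fin p => (⟨R.rot^[i] h, hbase i⟩ : {k // G.base k = G.base h})) := by
    constructor
    · intro i j hij
      exact Fin.ext (Function.iterate_injOn_Iio_minimalPeriod i.2 j.2 (congrArg Subtype.val hij))
    · rintro ⟨k, hk⟩
      obtain ⟨n, -, hn⟩ := ((R.sameCycle_iff _ _).2 hk.symm).exists_pow_eq'
      have hpos : 0 < p := Function.minimalPeriod_pos_of_mem_periodicPts
        (Function.Injective.mem_periodicPts R.rot.injective h)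
      refine ⟨⟨n % p, Nat.mod_lt _ hpos⟩, Subtype.ext ?_⟩
      dsimp only
      rw [hp, Function.iterate_mod_minimalPeriod_eq, ← hn, Equiv.Perm.coe_pow]
  have := Nat.card_eq_of_bijective _ hb
  rwa [Nat.card_fin] at this

section FourRegular

variable [Finite E] {R : G.RotationSystem}

theorem IsRegular.iterate_rot_inj (hG : G.IsRegular 4) {h : E × Bool} {i j : ℕ} (hi : i < 4) (hj : j < 4)
    (hij : R.rot^[i] h = R.rot^[j] h) : i = j := by
  have hp := R.minimalPeriod_rot h
  rw [hG] at hp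
  exact Function.iterate_injOn_Iio_minimalPeriod (by simpa [hp] using hi) (by simpa [hp] using hj) hij

theorem IsRegular.rot_four (hG : G.IsRegular 4) (h : E × Bool) : R.rot (R.rot (R.rot (R.rot h))) = h := by
  have hp := R.minimalPeriod_rot h
  rw [hG] at hp
  have := Function.iterate_minimalPeriod (f := R.rot) (x := h)
  rwa [hp] at this

theorem IsRegular.rot_ne (hG : G.IsRegular 4) (h : E × Bool) : R.rot h ≠ h := fun H =>
  absurd (hG.iterate_rot_inj (R := R) (i := 1) (j := 0) (by simp) (by simp) H) (by simp)

theorem IsRegular.rot_rot_ne (hG : G.IsRegular 4) (h : E × Bool) : R.rot (R.rot h) ≠ h := fun H =>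
  absurd (hG.iterate_rot_inj (R := R) (i := 2) (j := 0) (by simp) (by simp) H) (by simp)

theorem IsRegular.eq_of_base_eq (hG : G.IsRegular 4) {h k : E × Bool} (H : G.base k = G.base h) :
    k = h ∨ k = R.rot h ∨ k = R.rot (R.rot h) ∨ k = R.rot (R.rot (R.rot h)) := by
  obtain ⟨n, -, hn⟩ := ((R.sameCycle_iff _ _).2 H.symm).exists_pow_eq'
  rw [Equiv.Perm.coe_pow, ← Function.iterate_mod_minimalPeriod_eq, R.minimalPeriod_rot, hG] at hn
  have : n % 4 < 4 := Nat.mod_lt _ (by simp)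
  interval_cases n % 4 <;> simp_all [Function.iterate_succ_apply']

end FourRegular

/-- A 4-regular plane graph has no bridge, i.e. there are different faces on the two sides of every
edge. -/
theorem IsRegular.cycleMk_opp_ne [Finite E] {R : G.RotationSystem} (hG : G.IsRegular 4)
    (hR : R.IsPlane) (h : E × Bool) :
    (R.rot * opp E).cycleMk (opp E h) ≠ (R.rot * opp E).cycleMk h := by
  classical
  intro H
  have := Fintype.ofFinite E
  -- With the same face on both sides the edge alone would be a cut. Summing `z` over all half-edges
  -- gives 0, as each vertex occurs four times, but also the number of cut edges, which is 1.
  obtain ⟨z, hz, hz'⟩ := (R.isPlane_iff.1 hR).exists_vertex_potential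
    (x := Pi.single h.1 1) (by
      intro y
      rw [single_dotProduct, Equiv.Perm.coboundary_apply, H, one_mul, CharTwo.add_self_eq_zero])
  have h0 : ∑ k, z k = 0 := by
    refine Finset.sum_involution (fun k _ => R.rot (R.rot k)) ?_ ?_ ?_ ?_
    · intro k _
      rw [hz, hz, CharTwo.add_self_eq_zero]
    · intro k _ _
      exact hG.rot_rot_ne k
    · simp
    · intro k _
      exact hG.rot_four k
  have h1 : ∑ k, z k = ∑ e : E, (Pi.single h.1 1 : E → ZMod 2) e := by
    rw [Fintype.sum_prod_type]
    refine Finset.sum_congr rfl fun e _ => ?_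
    rw [Fintype.sum_bool]
    exact (hz' (e, true)).symm
  rw [h0, Finset.sum_pi_single'] at h1
  simp at h1

/-- The two faces that are separated by two half-edges consecutive at a vertex `v` on either side of
`v` are different if `v` is not a cut-vertex and no loop at `v` occupies one of the two sides. -/
theorem IsRegular.cycleMk_rot_rot_ne [Finite E] {R : G.RotationSystem} (hG : G.IsRegular 4)
    (hR : R.IsPlane) {a : E × Bool} (hcut : ¬ G.IsCutVertex (G.base a))
    (hab : opp E a ≠ R.rot a) (hcd : opp E (R.rot (R.rot a)) ≠ R.rot (R.rot (R.rot a))) :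
    (R.rot * opp E).cycleMk (R.rot (R.rot a)) ≠ (R.rot * opp E).cycleMk a := by
  classical
  intro H
  have := Fintype.ofFinite E
  set b := R.rot a with hb
  set c := R.rot b with hc
  have hba : b ≠ a := hG.rot_ne a
  have hca : c ≠ a := hG.rot_rot_ne a
  have hcb : c ≠ b := hG.rot_ne b
  have ha1 : a.1 ≠ b.1 := fun h => by
    rcases eq_or_eq_opp h with h | h
    · exact hba h.symm
    · exact hab (by rw [h, opp_opp])
  have hface (h : E × Bool) : (R.rot * opp E).cycleMk (opp E h) = (R.rot * opp E).cycleMk (R.rot h) := by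
    rw [← cycleMk_apply _ (opp E h), Equiv.Perm.mul_apply, opp_opp]
  -- Crossing the edges of `a` and `b` leads from the face at `a` to the face at `c`. If these
  -- coincide, the two edges form a closed curve in the dual, hence a cut.
  obtain ⟨z, hz, hz'⟩ := (R.isPlane_iff.1 hR).exists_vertex_potential
    (x := Pi.single a.1 1 + Pi.single b.1 1) (by
      intro y
      rw [add_dotProduct, single_dotProduct, single_dotProduct, Equiv.Perm.coboundary_apply,
        Equiv.Perm.coboundary_apply, hface, hface, ← hb, ← hc, H, one_mul, one_mul]
      exact CharTwo.add_eq_zero.2 (add_comm _ _))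
  have hza : z (opp E a) ≠ z a := by
    have := hz' a
    intro h
    rw [h, CharTwo.add_self_eq_zero] at this
    simp [Pi.single_eq_of_ne ha1] at this
  have hzb : z (opp E b) ≠ z b := by
    have := hz' b
    intro h
    rw [h, CharTwo.add_self_eq_zero] at this
    simp [Pi.single_eq_of_ne ha1.symm] at this
  have hzo {h : E × Bool} (h1 : h.1 ≠ a.1) (h2 : h.1 ≠ b.1) : z (opp E h) = z h := by
    have := hz' h
    rw [Pi.add_apply, Pi.single_eq_of_ne h1, Pi.single_eq_of_ne h2, add_zero] at this
    exact (CharTwo.add_eq_zero.1 this.symm).symm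
  have hbaseb : G.base b = G.base a := R.base_rot a
  have hbasec : G.base c = G.base a := (R.base_rot b).trans hbaseb
  have hzc : z c = z a := R.apply_eq hz hbasec
  have hzb' : z b = z a := R.apply_eq hz hbaseb
  have hc1 : c.1 ≠ a.1 := fun h => by
    rcases eq_or_eq_opp h with h | h
    · exact hca h
    · exact hza (by rw [← h, hzc])
  have hc2 : c.1 ≠ b.1 := fun h => by
    rcases eq_or_eq_opp h with h | h
    · exact hcb h
    · exact hzb (by rw [← h, hzc, hzb'])
  have hoa : G.base (opp E a) ≠ G.base a := fun h => hza (R.apply_eq hz h)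
  have hoc : G.base (opp E c) ≠ G.base a := fun h => by
    rcases hG.eq_of_base_eq (R := R) h with h | h | h | h
    · exact hc1 (by rw [← h]; rfl)
    · exact hc2 (by rw [hb, ← h]; rfl)
    · exact opp_ne c h
    · exact hcd h
  refine hcut ⟨_, _, hoa, hoc, .tail (.tail .refl ⟨opp E a, rfl, by rw [opp_opp]⟩)
    ⟨c, hbasec, rfl⟩, fun hr => ?_⟩
  -- Both edges of the cut are incident with the deleted vertex, so a walk avoiding it stays on one
  -- side. The other end of `a` lies across the cut, the other end of `c` does not.
  have key (w : V) (hw : G.ReachableAvoiding (G.base a) (G.base (opp E a)) w) :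
      ∀ h, G.base h = w → z h = z (opp E a) := by
    induction hw with
    | refl => exact fun h hh => R.apply_eq hz hh
    | @tail w w' _ hww' ih =>
      obtain ⟨⟨k, rfl, rfl⟩, h1, h2⟩ := hww'
      intro h hh
      have hne {l : E × Bool} (hl : G.base l = G.base a) : k.1 ≠ l.1 := fun hkl => by
        rcases eq_or_eq_opp hkl with rfl | rfl
        · exact h1 hl
        · exact h2 (by rw [opp_opp, hl])
      rw [R.apply_eq hz hh, hzo (hne rfl) (hne hbaseb), ih k rfl]
  have h1 := key _ hr _ rfl
  rw [hzo hc1 hc2, hzc] at h1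
  exact hza h1.symm

section Orientation

variable {R : G.RotationSystem} {σ : V → Set (Set (E × Bool))}

/-- Every half-edge is the first or the second one of its cell. -/
theorem RotationSystem.IsVertexOrientation.cell_rot_iff [Finite E]
    (hσ : R.IsVertexOrientation σ) (hG : G.IsRegular 4) (h : E × Bool) :
    {R.rot h, R.rot (R.rot h)} ∈ σ (G.base (R.rot h)) ↔ {h, R.rot h} ∉ σ (G.base h) := by
  obtain ⟨c, ⟨hc, hhc⟩, huniq⟩ := hσ.partition (R.rot h)
  constructor
  · intro h1 h2
    have e1 := huniq _ ⟨h1, by simp⟩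
    have e2 := huniq _ ⟨by rwa [R.base_rot], by simp⟩
    have : h ∈ ({R.rot h, R.rot (R.rot h)} : Set (E × Bool)) := by
      rw [e1, ← e2]
      simp
    rcases this with h | h
    · exact hG.rot_ne _ h.symm
    · exact hG.rot_rot_ne _ h.symm
  · intro h1
    obtain ⟨k, hk, rfl⟩ := hσ.consecutive _ c hc
    rcases hhc with h2 | h2
    · rwa [h2] at hc ⊢
    · obtain rfl : h = k := R.rot.injective h2
      rw [R.base_rot] at hc
      exact absurd hc h1

end Orientation

/-! ### From four colours of the faces to an o-colouring. -/

/-- The colour of an edge between two faces of given colours. -/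
def edgeColour (i j : Fin 4) : Fin 3 := ![![0, 0, 1, 2], ![0, 0, 2, 1], ![1, 2, 0, 0], ![2, 1, 0, 0]] i j

theorem edgeColour_comm : ∀ i j, edgeColour i j = edgeColour j i := by decide

/-- The colours are the three perfect matchings of the complete graph on the four face colours; two
edges with one common end belong to different matchings. The diagonal entries of the table are
arbitrary. -/
theorem edgeColour_ne : ∀ i j k, i ≠ j → j ≠ k → k ≠ i → edgeColour i j ≠ edgeColour j k := by
  decide

/-- Either `l` is the fourth colour, and opposite edges of the 4-cycle lie in one matching, or `l =
j`. -/
theorem edgeColour_pair : ∀ i j k l, j ≠ i → k ≠ j → l ≠ k → i ≠ l → k ≠ i →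
    (edgeColour k l = edgeColour i j ∧ edgeColour l i = edgeColour j k) ∨
      (edgeColour k l = edgeColour j k ∧ edgeColour l i = edgeColour i j) := by
  decide

end Multigraph

open Multigraph in
/-- The four colour theorem implies the assertion on o-colourings. -/
theorem FourColourTheorem.isOColourable (H : FourColourTheorem) {V E : Type} [Finite E]
    {G : Multigraph V E} {R : G.RotationSystem} (hR : R.IsPlane) (hG : G.IsRegular 4)
    (hcut : ∀ v, ¬ G.IsCutVertex v) {σ : V → Set (Set (E × Bool))} (hσ : R.IsVertexOrientation σ)
    (htr : ∀ v, G.IsLoopAnchor v → IsTransverseAt σ v) : G.IsOColourable 3 σ := by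
  -- The first half-edges of the cells. The face cycle of `h` passes the corner just before `h`, so
  -- the faces at `h` and `R.rot (R.rot h)` are those between the two cells.
  set S : Set (E × Bool) := {h | {h, R.rot h} ∈ σ (G.base h)} with hSdef
  have hS (h) : R.rot h ∈ S ↔ h ∉ S := hσ.cell_rot_iff hG h
  -- Transversality is exactly what excludes a loop filling a cell, the exception in
  -- `cycleMk_rot_rot_ne`.
  have hloop {h : E × Bool} (hh : h ∈ S) : opp E h ≠ R.rot h := fun e => by
    have hbase : G.base (opp E h) = G.base h := by rw [e, R.base_rot]
    have hc : {h, opp E h} ∈ σ (G.base h) := by rw [e]; exact hh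
    rcases h with ⟨e', _ | _⟩
    · exact htr _ ⟨e', rfl, hbase⟩ e' hc
    · refine htr _ ⟨e', hbase, rfl⟩ e' ?_
      rw [Set.pair_comm]
      exact hc
  obtain ⟨y, hy, hy1, hy2⟩ := H.exists_face_colouring (R.isPlane_iff.1 hR) opp_opp opp_ne
    hG.rot_four hG.rot_rot_ne hS (hG.cycleMk_opp_ne hR) fun h hh =>
      hG.cycleMk_rot_rot_ne hR (hcut _) (hloop hh)
        (hloop (by rw [hS, hS, not_not]; exact hh))
  have hy3 (h) : y (opp E h) = y (R.rot h) := by rw [← hy (opp E h), opp_opp]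
  let ε : E → Fin 3 := fun e => edgeColour (y (e, false)) (y (e, true))
  have hε (h : E × Bool) : ε h.1 = edgeColour (y h) (y (R.rot h)) := by
    rw [← hy3]
    rcases h with ⟨e, _ | _⟩
    · rfl
    · exact edgeColour_comm _ _
  have hne (h) : y (R.rot h) ≠ y h := by
    rw [← hy3]
    exact hy1 h
  have hcell {h : E × Bool} (hh : h ∈ S) :
      ε h.1 ≠ ε (R.rot h).1 ∧ G.coloursAt ε (G.base h) = {ε h.1, ε (R.rot h).1} := by
    have h4 : R.rot (R.rot (R.rot (R.rot h))) = h := hG.rot_four h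
    constructor
    · rw [hε, hε]
      exact edgeColour_ne _ _ _ (hne h).symm (hne _).symm (hy2 h hh)
    · have hp := edgeColour_pair (y h) (y (R.rot h)) (y (R.rot (R.rot h)))
        (y (R.rot (R.rot (R.rot h)))) (hne _) (hne _) (hne _)
        (by have := hne (R.rot (R.rot (R.rot h))); rwa [h4] at this) (hy2 h hh)
      have e3 := hε (R.rot (R.rot h))
      have e4 := hε (R.rot (R.rot (R.rot h)))
      rw [h4] at e4
      rw [← hε h, ← hε (R.rot h), ← e3, ← e4] at hp
      ext x
      constructor
      · rintro ⟨k, hk, rfl⟩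
        rcases hG.eq_of_base_eq (R := R) hk with rfl | rfl | rfl | rfl
        · exact .inl rfl
        · exact .inr rfl
        · rcases hp with hp | hp
          · exact .inl hp.1
          · exact .inr hp.1
        · rcases hp with hp | hp
          · exact .inr hp.2
          · exact .inl hp.2
      · rintro (rfl | rfl)
        · exact ⟨h, rfl, rfl⟩
        · exact ⟨R.rot h, R.base_rot h, rfl⟩
  refine ⟨ε, fun v => ⟨?_, fun c hc x hx => ?_⟩⟩
  · obtain ⟨h, rfl, hh⟩ : ∃ h, G.base h = v ∧ h ∈ S := by
      have hcard := hG v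
      have : Nonempty {h // G.base h = v} := by
        by_contra hn
        rw [not_nonempty_iff] at hn
        rw [degree, Nat.card_of_isEmpty] at hcard
        omega
      obtain ⟨k, hk⟩ := this
      by_cases hkS : k ∈ S
      · exact ⟨k, hk, hkS⟩
      · exact ⟨R.rot k, (R.base_rot k).trans hk, (hS k).2 hkS⟩
    rw [(hcell hh).2, Set.ncard_pair (hcell hh).1]
  · obtain ⟨h, rfl, rfl⟩ := hσ.consecutive v c hc
    rw [(hcell hc).2] at hx
    rcases hx with rfl | rfl
    · exact ⟨h, by simp, rfl⟩
    · exact ⟨R.rot h, by simp, rfl⟩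

theorem theorem2p1 :
    FourColourTheorem ↔
      ∀ (V E : Type) [Finite V] [Finite E] (G : Multigraph V E) (R : G.RotationSystem),
        R.IsPlane → G.IsRegular 4 → (∀ v, ¬ G.IsCutVertex v) →
        ∀ σ : V → Set (Set (E × Bool)), R.IsVertexOrientation σ →
          (∀ v, G.IsLoopAnchor v → Multigraph.IsTransverseAt σ v) →
          G.IsOColourable 3 σ :=
  ⟨fun H _ _ _ _ _ _ hR hG hcut _ hσ htr => H.isOColourable hR hG hcut hσ htr,
    fourColourTheorem_of_oColouring⟩
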